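/- **Definitions.** Let $\Gamma$ be a group generated by a finite set $S$, with the left-invariant word metric $d_S$, and let $L$ be a $\mathbb Z\Gamma$-module. Let $P$ be a finite-dimensional connected locally finite simplicial complex on which $\Gamma$ acts by simplicial automorphisms (the action need be neither free nor proper) preserving some ordering of the vertices of each simplex. A *Lipschitz map* is a map $\alpha:\Gamma\times P\to\mathbb R^n$, continuous in $P$, such that 1. $\alpha(g\gamma,gx)=\alpha(\gamma,x)$ for all $g,\gamma\in\Gamma$, $x\in P$; 2. $\alpha(\gamma,\cdot):P\to\mathbb R^n$ is proper for every $\gamma\in\Gamma$; 3. $\|\alpha(\gamma,x)-\alpha(\delta,x)\|\le d_S(\gamma,\delta)$ for all $\gamma,\delta\in\Gamma$, $x\in P$. Put $\bar\alpha(\sum_i t_i\gamma_i,x)=\sum_i t_i\,\alpha(\gamma_i,x)$ for barycentric coordinates $t_i$. Let $\omega$ be a compactly supported integral singular cocycle on $\mathbb R^n$ whose class generates $H^n_c(\mathbb R^n;\mathbb Z)$. For a $\Gamma$-invariant infinite simplicial cycle $z=\sum_\sigma\lambda_\sigma\sigma$ of dimension $n-k$ on $P$ with $\lambda_\sigma\in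 L$, $\lambda_{\gamma\sigma}=\gamma\lambda_\sigma$, let $\alpha_\cap([z])\in H^k(\Gamma;L)$ be the class of the homogeneous cocycle $$[\gamma_0,\dots,\gamma_k]\longmapsto\sum_\sigma\omega\bigl(\bar\alpha|_{[\gamma_0,\dots,\gamma_k]\times\sigma}\bigr)\lambda_\sigma ,$$ where the product of simplices carries the staircase triangulation (the sum is finite). A class in $H^k(\Gamma;L)$ is *Lipschitz* (in the general, non-proper sense) if it equals $\alpha_\cap([z])$ for some such $P,n,\alpha,\omega,z$. **Statement.** Let $\Gamma$ be a group with a finite generating set $S$. Then every class $a\in H^1(\Gamma;\mathbb Z)$ (trivial coefficients) is Lipschitz. More precisely, let $f:\Gamma\to\mathbb Z$ be the 1-cocycle (homomorphism) representing $a$, let $P=\mathbb R$ be triangulated with vertex set $\mathbb Z$ and edges $[m,m+1]$, let $\Gamma$ act on $P$ by the translations $\gamma(x)=x+f(\gamma)$, and let $z=\sum_{m\in\mathbb Z}m$ be the 0-cycle that is the sum of all vertices. For every real $c>0$ with $c\,|f(s)|\le1$ for all $s\in S$, the map $$\alpha:\Gamma\times\mathbb R\to\mathbb R,\qquad \alpha(\gamma,x)=-c\,\gamma^{-1}(x),$$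 is a Lipschitz map, and $\alpha_\cap([z])=a$ for a suitable choice of $\omega$. -/

import Mathlib

namespace LipschitzCohomology

/-! ### Word metric -/

/-- The word length of `g` with respect to `S`: the least length of a word in the elements of `S`
and their inverses that represents `g`. -/
noncomputable def wordLength {Γ : Type} [Group Γ] (S : Finset Γ) (g : Γ) : ℕ :=
  sInf {n | ∃ l : List Γ, l.length = n ∧ (∀ x ∈ l, x ∈ S ∨ x⁻¹ ∈ S) ∧ l.prod = g}

/-- The (left-invariant) word metric `d_S`. -/
noncomputable def wordDist {Γ : Type} [Group Γ] (S : Finset Γ) (g h : Γ) : ℝ :=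
  wordLength S (g⁻¹ * h)

/-! ### Simplicial complexes with a simplicial group action -/

/-- A finite-dimensional locally finite simplicial complex with vertex set `V` on which the group
`Γ` acts (not necessarily freely or properly) by simplicial automorphisms, together with a
`Γ`-invariant ordering of the vertices of each simplex. The ordering orients the simplices and
specifies the staircase triangulations of their products with other ordered simplices. -/
structure GComplex (Γ : Type) [Group Γ] (V : Type) where
  complex : AbstractSimplicialComplex V
  act : Γ →* Equiv.Perm V
  act_mem : ∀ (g : Γ) (s : Finset V), s ∈ complex → s.map (act g).toEmbedding ∈ complex
  rel : V → V → Prop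
  rel_irrefl : ∀ u, ¬ rel u u
  rel_trans : ∀ s ∈ complex, ∀ u ∈ s, ∀ v ∈ s, ∀ w ∈ s, rel u v → rel v w → rel u w
  rel_total : ∀ s ∈ complex, ∀ u ∈ s, ∀ v ∈ s, u ≠ v → rel u v ∨ rel v u
  act_rel : ∀ (g : Γ) (u v : V), rel u v → rel (act g u) (act g v)
  locallyFinite : ∀ v : V, {s : Finset V | s ∈ complex ∧ v ∈ s}.Finite
  finiteDim : ∃ d : ℕ, ∀ s ∈ complex, s.card ≤ d + 1

namespace GComplex

variable {Γ : Type} [Group Γ] {V : Type} (P : GComplex Γ V)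

/-- The geometric realization `|P|` in barycentric coordinates. As `P` is locally finite, the weak
topology is the topology of pointwise convergence of barycentric coordinates. -/
abbrev Realization : Type :=
  {x : V → ℝ // ∃ s ∈ P.complex, (∀ v, v ∉ s → x v = 0) ∧ (∀ v, 0 ≤ x v) ∧ ∑ v ∈ s, x v = 1}

/-- The action of `Γ` on `|P|`, linear on each simplex. -/
def translate (g : Γ) (x : P.Realization) : P.Realization :=
  ⟨fun v => x.1 (P.act g⁻¹ v), by
    obtain ⟨x, s, hs, h0, hpos, hsum⟩ := x
    refine ⟨s.map (P.act g).toEmbedding, P.act_mem g s hs, ?_, fun v => hpos _, ?_⟩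
    · intro v hv
      apply h0
      intro hmem
      apply hv
      rw [Finset.mem_map]
      exact ⟨_, hmem, by simp [map_inv]⟩
    · simpa [Finset.sum_map, map_inv] using hsum⟩

/-- The `m`-simplices of `P`, each listed by its vertices in increasing order. -/
def Simplex (m : ℕ) : Type :=
  {v : Fin (m + 1) → V //
    (∃ s ∈ P.complex, (s : Set V) = Set.range v) ∧ ∀ i j, i < j → P.rel (v i) (v j)}

/-- The action of `Γ` on the set of `m`-simplices. -/
def moveSimplex {m : ℕ} (g : Γ) (σ : P.Simplex m) : P.Simplex m :=
  ⟨fun i => P.act g (σ.1 i), by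
    obtain ⟨v, ⟨s, hs, hr⟩, hv⟩ := σ
    refine ⟨⟨s.map (P.act g).toEmbedding, P.act_mem g s hs, ?_⟩,
      fun i j hij => P.act_rel g _ _ (hv i j hij)⟩
    simp only [Finset.coe_map, hr, ← Set.range_comp]
    rfl⟩

/-- The characteristic map `Δ^m → |P|` of an `m`-simplex, `t ↦ ∑ j, t j • v_j`. -/
noncomputable def charMap {m : ℕ} (σ : P.Simplex m) :
    C(stdSimplex ℝ (Fin (m + 1)), P.Realization) := by
  classical
  exact
  { toFun := fun t => ⟨fun v => ∑ j, if σ.1 j = v then t j else 0, by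
      obtain ⟨w, ⟨s, hs, hr⟩, hw⟩ := σ
      have hmem : ∀ j, w j ∈ s := fun j => by
        have : w j ∈ (s : Set V) := hr ▸ Set.mem_range_self j
        exact this
      refine ⟨s, hs, ?_, ?_, ?_⟩
      · intro v hv
        refine Finset.sum_eq_zero fun j _ => ?_
        have : w j ≠ v := fun h => hv (h ▸ hmem j)
        simp [this]
      · intro v
        refine Finset.sum_nonneg fun j _ => ?_
        split_ifs
        · exact t.2.1 j
        · exact le_rfl
      · rw [Finset.sum_comm]
        simp only [Finset.sum_ite_eq, hmem, if_true]
        exact t.2.2⟩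
    continuous_toFun := by
      refine Continuous.subtype_mk (continuous_pi fun v => ?_) _
      refine continuous_finsetSum _ fun j _ => ?_
      split_ifs
      · exact (continuous_apply j).comp continuous_subtype_val
      · exact continuous_const }

/-! ### Infinite invariant chains -/

/-- An infinite simplicial `m`-chain `∑ σ, z σ • σ` on `P` with coefficients in the `ℤΓ`-module `L`
is `Γ`-invariant if `z (g σ) = g (z σ)`. -/
def IsInvariantChain (L : Rep ℤ Γ) {m : ℕ} (z : P.Simplex m → L) : Prop :=
  ∀ (g : Γ) (σ : P.Simplex m), z (P.moveSimplex g σ) = L.ρ g (z σ)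

open Classical in
/-- The boundary of an infinite simplicial chain: the coefficient of `τ` is the sum, finite since
`P` is locally finite, of `(-1)^i z σ` over all `σ` and `i` such that `τ` is the `i`-th face
of `σ`. -/
noncomputable def boundary {L : Type} [AddCommGroup L] {m : ℕ} (z : P.Simplex (m + 1) → L)
    (τ : P.Simplex m) : L :=
  ∑ᶠ σ : P.Simplex (m + 1), ∑ i : Fin (m + 2),
    if τ.1 = (fun j => σ.1 (i.succAbove j)) then (-1 : ℤ) ^ (i : ℕ) • z σ else 0

/-- An infinite simplicial chain is a cycle if its boundary vanishes (no condition in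
dimension 0). -/
def IsCycle {L : Type} [AddCommGroup L] : {m : ℕ} → (P.Simplex m → L) → Prop
  | 0, _ => True
  | _ + 1, z => ∀ τ, P.boundary z τ = 0

end GComplex

/-! ### Singular cochains with compact supports -/

/-- Singular `n`-simplices of `X`. -/
abbrev SingularSimplex (n : ℕ) (X : Type) [TopologicalSpace X] : Type :=
  C(stdSimplex ℝ (Fin (n + 1)), X)

/-- Integral singular `n`-cochains of `X`, as functions on the singular `n`-simplices. -/
abbrev SingularCochain (n : ℕ) (X : Type) [TopologicalSpace X] : Type :=
  SingularSimplex n X → ℤ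

section Singular

variable {X : Type} [TopologicalSpace X]

/-- The `i`-th face of a singular simplex. -/
noncomputable def singularFace {n : ℕ} (i : Fin (n + 2)) (τ : SingularSimplex (n + 1) X) :
    SingularSimplex n X :=
  τ.comp ⟨stdSimplex.map i.succAbove, stdSimplex.continuous_map _⟩

/-- The singular coboundary. -/
noncomputable def coboundary {n : ℕ} (ω : SingularCochain n X) : SingularCochain (n + 1) X :=
  fun τ => ∑ i : Fin (n + 2), (-1 : ℤ) ^ (i : ℕ) * ω (singularFace i τ)

/-- A cochain has compact support if it vanishes on all simplices that miss some compact set. -/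
def HasCompactSupp {n : ℕ} (ω : SingularCochain n X) : Prop :=
  ∃ K : Set X, IsCompact K ∧ ∀ τ : SingularSimplex n X, Disjoint (Set.range τ) K → ω τ = 0

/-- Cocycles of the complex of compactly supported singular cochains. -/
def IsCompactCocycle {n : ℕ} (ω : SingularCochain n X) : Prop :=
  HasCompactSupp ω ∧ coboundary ω = 0

/-- Coboundaries of the complex of compactly supported singular cochains. -/
def IsCompactCoboundary : {n : ℕ} → SingularCochain n X → Prop
  | 0, ω => ω = 0
  | n + 1, ω => ∃ η : SingularCochain n X, HasCompactSupp η ∧ coboundary η = ω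

/-- `ω` is a compactly supported cocycle whose class generates `H^n_c(X; ℤ)` as a group. -/
def IsCompactGenerator {n : ℕ} (ω : SingularCochain n X) : Prop :=
  IsCompactCocycle ω ∧ ∀ ω' : SingularCochain n X, IsCompactCocycle ω' →
    ∃ r : ℤ, IsCompactCoboundary (ω' - r • ω)

end Singular

/-! ### The homomorphism `α_∩` -/

section Slant

variable {Γ : Type} [Group Γ] {V : Type} (P : GComplex Γ V)

/-- The extension of `α` to a simplex `[γ_0, …, γ_k]` of `Δ^∞(Γ)` by barycentric coordinates:
`ᾱ (∑ i, t_i γ_i, x) = ∑ i, t_i α (γ_i, x)`. -/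
noncomputable def alphaBar {n k : ℕ}
    (α : Γ → C(P.Realization, EuclideanSpace ℝ (Fin n))) (γ : Fin (k + 1) → Γ) :
    C(stdSimplex ℝ (Fin (k + 1)) × P.Realization, EuclideanSpace ℝ (Fin n)) where
  toFun y := ∑ i, y.1 i • α (γ i) y.2
  continuous_toFun := by
    refine continuous_finsetSum _ fun i _ => ?_
    have h1 : Continuous fun y : stdSimplex ℝ (Fin (k + 1)) × P.Realization => y.1 i :=
      (continuous_apply i).comp (continuous_subtype_val.comp continuous_fst)
    exact h1.smul ((α (γ i)).continuous.comp continuous_snd)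

/-- The restriction of `ᾱ` to the top-dimensional simplex of the staircase triangulation of
`[γ_0, …, γ_k] × σ` whose vertices are the pairs of vertices with indices `p 0 < p 1 < …`. -/
noncomputable def stairSimplex {n k m : ℕ}
    (α : Γ → C(P.Realization, EuclideanSpace ℝ (Fin n))) (γ : Fin (k + 1) → Γ)
    (σ : P.Simplex m) (p : Fin (k + m + 1) → Fin (k + 1) × Fin (m + 1)) :
    SingularSimplex (k + m) (EuclideanSpace ℝ (Fin n)) :=
  (alphaBar P α γ).comp
    (ContinuousMap.prodMk
      ⟨stdSimplex.map fun j => (p j).1, stdSimplex.continuous_map _⟩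
      ((P.charMap σ).comp ⟨stdSimplex.map fun j => (p j).2, stdSimplex.continuous_map _⟩))

/-- The number of unit squares under the staircase path `p`; its parity is the sign of the
corresponding shuffle. -/
def stairArea {k m : ℕ} (p : Fin (k + m + 1) → Fin (k + 1) × Fin (m + 1)) : ℕ :=
  ∑ j : Fin (k + m), ((p j.succ).1 - (p j.castSucc).1 : ℕ) * ((p j.castSucc).2 : ℕ)

open Classical in
/-- `φ (Δ ⊗ σ) = ω (ᾱ|Δ × σ)` for `Δ = [γ_0, …, γ_k]`: the singular chain `ᾱ|Δ × σ` is the signed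
sum over the simplices of the staircase triangulation, i.e. the maximal chains of
`{0, …, k} × {0, …, m}`. -/
noncomputable def phi {k m : ℕ}
    (α : Γ → C(P.Realization, EuclideanSpace ℝ (Fin (k + m))))
    (ω : SingularCochain (k + m) (EuclideanSpace ℝ (Fin (k + m))))
    (γ : Fin (k + 1) → Γ) (σ : P.Simplex m) : ℤ :=
  ∑ p : Fin (k + m + 1) → Fin (k + 1) × Fin (m + 1) with StrictMono p,
    (-1) ^ stairArea p * ω (stairSimplex P α γ σ p)

/-- The equivariant cochain `φ̄/z : [γ_0, …, γ_k] ↦ ∑ σ, φ ([γ_0, …, γ_k] ⊗ σ) • z σ`; the sum is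
finite if `α` is as in `IsLipschitzMap` and `ω` has compact support. -/
noncomputable def slant {L : Type} [AddCommGroup L] {k m : ℕ}
    (α : Γ → C(P.Realization, EuclideanSpace ℝ (Fin (k + m))))
    (ω : SingularCochain (k + m) (EuclideanSpace ℝ (Fin (k + m))))
    (z : P.Simplex m → L) (γ : Fin (k + 1) → Γ) : L :=
  ∑ᶠ σ : P.Simplex m, phi P α ω γ σ • z σ

/-- The conditions on a map `α : Γ × P → ℝ^n` in the definition of Lipschitz cohomology classes
(`Γ` is discrete, so that `α` is a family of continuous maps on `|P|`). -/
structure IsLipschitzMap (S : Finset Γ) {n : ℕ}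
    (α : Γ → C(P.Realization, EuclideanSpace ℝ (Fin n))) : Prop where
  invariant : ∀ (g γ : Γ) (x : P.Realization), α (g * γ) (P.translate g x) = α γ x
  proper : ∀ γ : Γ, IsProperMap (α γ)
  lipschitz : ∀ (x : P.Realization) (γ δ : Γ), dist (α γ x) (α δ x) ≤ wordDist S γ δ

end Slant

/-- The inhomogeneous cochain `c` is a cocycle and `a` is its class in group cohomology. -/
def IsClassOf {Γ : Type} [Group Γ] {L : Rep ℤ Γ} {k : ℕ} (c : (Fin k → Γ) → L)
    (a : groupCohomology L k) : Prop :=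
  ∃ h : inhomogeneousCochains.d L k c = 0,
    groupCohomology.π L k (groupCohomology.cocyclesMk c h) = a

/-- `α` is a Lipschitz map on `Γ × P`, `z` is a `Γ`-invariant infinite `m`-cycle on `P` with
coefficients in `L`, and `a = α_∩([z])`: for a cocycle `ω` generating `H^n_c(ℝ^n; ℤ)`, `n = k + m`,
the class `a` is represented by the equivariant homogeneous cocycle `φ̄/z`, i.e. by the
inhomogeneous cocycle
`(g_1, …, g_k) ↦ (φ̄/z) [1, g_1, g_1 g_2, …, g_1 ⋯ g_k]`. -/
def Realizes {Γ : Type} [Group Γ] (S : Finset Γ) {L : Rep ℤ Γ} {k m : ℕ} {V : Type}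
    (P : GComplex Γ V) (α : Γ → C(P.Realization, EuclideanSpace ℝ (Fin (k + m))))
    (z : P.Simplex m → L) (a : groupCohomology L k) : Prop :=
  IsLipschitzMap P S α ∧ P.IsInvariantChain L z ∧ P.IsCycle z ∧
    ∃ ω : SingularCochain (k + m) (EuclideanSpace ℝ (Fin (k + m))), IsCompactGenerator ω ∧
      IsClassOf (fun g : Fin k → Γ => slant P α ω z (Fin.partialProd g)) a

/-- `a ∈ H^k(Γ; L)` is a Lipschitz cohomology class in the general (non-proper) sense, with respect
to the word metric of the finite generating set `S`: it is in the image of `α_∩` for some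
finite-dimensional connected locally finite simplicial complex `P` with a simplicial action of `Γ`
and some Lipschitz map `α : Γ × P → ℝ^n`. (Such a `P` has countably many vertices, so the vertex
set may be taken in the lowest universe.) -/
def IsLipschitzClass {Γ : Type} [Group Γ] (S : Finset Γ) {L : Rep ℤ Γ} {k : ℕ}
    (a : groupCohomology L k) : Prop :=
  ∃ (V : Type) (P : GComplex Γ V), ConnectedSpace P.Realization ∧
    ∃ (m : ℕ) (α : Γ → C(P.Realization, EuclideanSpace ℝ (Fin (k + m)))) (z : P.Simplex m → L),
      Realizes S P α z a

/-! ### The real line -/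

/-- The real line, triangulated with vertex set `ℤ` and edges `{m, m + 1}`, on which `Γ` acts by
the translations `γ(x) = x + f(γ)`. -/
def line {Γ : Type} [Group Γ] (f : Γ → ℤ) (hf : ∀ γ δ, f (γ * δ) = f γ + f δ) : GComplex Γ ℤ where
  complex :=
    { faces := {s | s.Nonempty ∧ ∃ m : ℤ, s ⊆ {m, m + 1}}
      isRelLowerSet_faces := by
        rintro s ⟨hs, m, hm⟩
        exact ⟨hs, fun t hts ht => ⟨ht, m, Finset.Subset.trans hts hm⟩⟩
      singleton_mem := fun v => ⟨Finset.singleton_nonempty v, v, by simp⟩ }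
  act :=
    { toFun := fun γ => Equiv.addRight (f γ)
      map_one' := by
        have h : f 1 = 0 := by simpa using hf 1 1
        ext x
        simp [h]
      map_mul' := fun γ δ => by
        ext x
        simp [hf]
        ring }
  act_mem := by
    rintro g s ⟨hs, m, hm⟩
    refine ⟨by simpa using hs, m + f g, ?_⟩
    intro v hv
    rw [Finset.mem_map] at hv
    obtain ⟨w, hw, rfl⟩ := hv
    have := hm hw
    simp only [Finset.mem_insert, Finset.mem_singleton] at this
    simp only [Finset.mem_insert, Finset.mem_singleton, Equiv.toEmbedding_apply, MonoidHom.coe_mk,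
      OneHom.coe_mk, Equiv.coe_addRight]
    omega
  rel u v := u < v
  rel_irrefl := lt_irrefl
  rel_trans _ _ _ _ _ _ _ _ := lt_trans
  rel_total _ _ _ _ _ _ := lt_or_gt_of_ne
  act_rel g u v h := by simpa using h
  locallyFinite v := by
    refine (Finset.finite_toSet (Finset.Icc (v - 1) (v + 1)).powerset).subset ?_
    rintro s ⟨⟨_, m, hm⟩, hv⟩
    rw [Finset.mem_coe, Finset.mem_powerset]
    intro w hw
    have h1 := hm hw
    have h2 := hm hv
    simp only [Finset.mem_insert, Finset.mem_singleton] at h1 h2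
    rw [Finset.mem_Icc]
    omega
  finiteDim := by
    refine ⟨1, ?_⟩
    rintro s ⟨_, m, hm⟩
    exact (Finset.card_le_card hm).trans Finset.card_le_two

end LipschitzCohomology

open LipschitzCohomology

namespace LipschitzCohomology

/-! Take `ω` to be the coboundary of the indicator of `[0, ∞)`; on a path it is the difference of
that indicator at the two ends. Over a vertex `v` the staircase triangulation of `[γ₀, γ₁] × v` is a
single path from `α(γ₀, v)` to `α(γ₁, v)`, and `α(γ, v) = -c (v - f γ)` is nonnegative exactly when
`v ≤ f γ`. Summing over `v` therefore counts, with sign, the integers between `f γ₀` and `f γ₁`,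
which gives `f γ₁ - f γ₀`, the homogeneous form of `f` (`slant_lineMap`).

That `ω` generates `H^1_c(ℝ; ℤ)` (`isCompactGenerator_stepCocycle`) is proved by hand. By coning to
the origin, every 1-cocycle is `δg` for a function `g` (`cocycle_eq_coboundary`). Compact support
makes `g` constant near each end, and subtracting a constant and a multiple of the step leaves a
compactly supported function.

The map is proper because each `α(γ, ·)` is a homeomorphism. It is Lipschitz because `α(γ, x) - α(δ,
x)` has norm `c |f(γ⁻¹δ)|`, to which each letter of a word contributes at most 1. -/

lemma coboundary_one_apply {X : Type} [TopologicalSpace X] (ω : SingularCochain 1 X)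
    (τ : SingularSimplex 2 X) :
    coboundary ω τ = ω (singularFace 0 τ) - ω (singularFace 1 τ) + ω (singularFace 2 τ) := by
  refine (Fin.sum_univ_three _).trans ?_
  simp
  ring

lemma sum_stdSimplex_map_smul {E : Type} [AddCommGroup E] [Module ℝ E] {ι κ : Type} [Fintype ι]
    [Fintype κ] (f : ι → κ) (t : stdSimplex ℝ ι) (p : κ → E) :
    ∑ y, stdSimplex.map f t y • p y = ∑ x, t x • p (f x) := by
  classical
  simp only [stdSimplex.map_coe, FunOnFinite.linearMap_apply_apply, Finset.sum_smul]
  rw [← Finset.sum_fiberwise Finset.univ f (fun x => t x • p (f x))]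
  refine Finset.sum_congr rfl fun y _ => Finset.sum_congr rfl fun x hx => ?_
  rw [(Finset.mem_filter.1 hx).2]

/-! ### Affine simplices and singular cochains of low degree -/

section AffineSimplices

variable {E : Type} [AddCommGroup E] [Module ℝ E] [TopologicalSpace E] [ContinuousAdd E]
  [ContinuousSMul ℝ E]

/-- The affine singular simplex with vertices `p 0, …, p n`. -/
noncomputable def affineSimplex {n : ℕ} (p : Fin (n + 1) → E) : SingularSimplex n E where
  toFun t := ∑ i, t i • p i
  continuous_toFun := continuous_finsetSum _ fun i _ =>
    ((continuous_apply i).comp continuous_subtype_val).smul continuous_const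

lemma affineSimplex_pair_apply (a b : E) (t : stdSimplex ℝ (Fin 2)) :
    affineSimplex (n := 1) ![a, b] t = t 0 • a + t 1 • b := by
  simp [affineSimplex]

lemma affineSimplex_pair_vertex_zero (a b : E) :
    affineSimplex (n := 1) ![a, b] (stdSimplex.vertex 0) = a := by
  simp [affineSimplex_pair_apply]

lemma affineSimplex_pair_vertex_one (a b : E) :
    affineSimplex (n := 1) ![a, b] (stdSimplex.vertex 1) = b := by
  simp [affineSimplex_pair_apply]

lemma singularFace_comp_affineSimplex {X : Type} [TopologicalSpace X] (F : C(E, X)) {n : ℕ}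
    (p : Fin (n + 2) → E) (i : Fin (n + 2)) :
    singularFace i (F.comp (affineSimplex p)) = F.comp (affineSimplex (p ∘ i.succAbove)) := by
  ext t
  exact congrArg F (sum_stdSimplex_map_smul i.succAbove t p)

/-- The cocycle condition on the image of one affine triangle. The vertices may coincide, so
degenerate triangles are covered too. -/
lemma cocycle_triangle {X : Type} [TopologicalSpace X] {ω : SingularCochain 1 X}
    (hω : coboundary ω = 0) (F : C(E, X)) (a b c : E) :
    ω (F.comp (affineSimplex ![b, c])) - ω (F.comp (affineSimplex ![a, c])) +
      ω (F.comp (affineSimplex ![a, b])) = 0 := by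
  have h := congrFun hω (F.comp (affineSimplex ![a, b, c]))
  rw [coboundary_one_apply] at h
  simp only [singularFace_comp_affineSimplex] at h
  have h0 : ![a, b, c] ∘ (0 : Fin 3).succAbove = ![b, c] := by ext i; fin_cases i <;> rfl
  have h1 : ![a, b, c] ∘ (1 : Fin 3).succAbove = ![a, c] := by ext i; fin_cases i <;> rfl
  have h2 : ![a, b, c] ∘ (2 : Fin 3).succAbove = ![a, b] := by ext i; fin_cases i <;> rfl
  rwa [h0, h1, h2] at h

end AffineSimplices

/-- The singular `0`-cochain with values `h x` on the points `x`. -/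
noncomputable def pointCochain {X : Type} [TopologicalSpace X] (h : X → ℤ) : SingularCochain 0 X :=
  fun τ => h (τ (stdSimplex.vertex 0))

lemma coboundary_pointCochain {X : Type} [TopologicalSpace X] (h : X → ℤ)
    (τ : SingularSimplex 1 X) :
    coboundary (pointCochain h) τ =
      h (τ (stdSimplex.vertex 1)) - h (τ (stdSimplex.vertex 0)) := by
  simp [coboundary, pointCochain, singularFace, Fin.sum_univ_two]
  rfl

lemma coboundary_coboundary_pointCochain {X : Type} [TopologicalSpace X] (h : X → ℤ) :
    coboundary (coboundary (pointCochain h)) = 0 := by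
  funext τ
  have h21 : (2 : Fin 3).succAbove (1 : Fin 2) = 1 := rfl
  have h11 : (1 : Fin 3).succAbove (1 : Fin 2) = 2 := rfl
  have h01 : (0 : Fin 3).succAbove (1 : Fin 2) = 2 := rfl
  have h20 : (2 : Fin 3).succAbove (0 : Fin 2) = 0 := rfl
  have h10 : (1 : Fin 3).succAbove (0 : Fin 2) = 0 := rfl
  have h00 : (0 : Fin 3).succAbove (0 : Fin 2) = 1 := rfl
  rw [coboundary_one_apply]
  simp only [coboundary_pointCochain, singularFace, ContinuousMap.comp_apply,
    ContinuousMap.coe_mk, stdSimplex.map_vertex, h21, h11, h01, h20, h10, h00]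
  exact Eq.trans (by ring) (sub_self (h (τ (stdSimplex.vertex 0))))

/-! ### Contractibility: 1-cocycles are coboundaries -/

section Cone

variable {E : Type} [AddCommGroup E] [Module ℝ E] [TopologicalSpace E] [ContinuousAdd E]
  [ContinuousSMul ℝ E]

/-- A singular `1`-simplex as a path on `ℝ`, constant outside the unit interval. -/
noncomputable def extendPath {X : Type} [TopologicalSpace X] (τ : SingularSimplex 1 X) : C(ℝ, X) :=
  τ.comp ⟨fun s => stdSimplexHomeomorphUnitInterval.symm (Set.projIcc 0 1 zero_le_one s),
    stdSimplexHomeomorphUnitInterval.symm.continuous.comp continuous_projIcc⟩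

lemma extendPath_apply {X : Type} [TopologicalSpace X] (τ : SingularSimplex 1 X)
    (t : stdSimplex ℝ (Fin 2)) : extendPath τ (t 1) = τ t := by
  have h : Set.projIcc (0 : ℝ) 1 zero_le_one (t 1) = stdSimplexHomeomorphUnitInterval t :=
    Set.projIcc_of_mem _ ⟨t.2.1 1, stdSimplex.le_one t 1⟩
  simp [extendPath, h]

/-- On a real topological vector space, a singular `1`-cocycle is the coboundary of its values on
straight paths from the origin. -/
lemma cocycle_eq_coboundary {ω : SingularCochain 1 E} (hω : coboundary ω = 0) :
    ω = coboundary (pointCochain fun x => ω (affineSimplex ![0, x])) := by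
  funext τ
  -- `F` cones the path to the origin: the top side of the unit square is `τ`, the vertical sides
  -- are the rays to its endpoints, and the bottom collapses to 0. The two triangles below share the
  -- diagonal, which cancels.
  let F : C(ℝ × ℝ, E) := ⟨fun q => q.2 • extendPath τ q.1, by fun_prop⟩
  have key1 := cocycle_triangle hω F (0, 0) (0, 1) (1, 1)
  have key2 := cocycle_triangle hω F (0, 0) (1, 0) (1, 1)
  -- The fully degenerate triangle shows that `ω` vanishes on the constant path at the origin, hence
  -- on the bottom side.
  have key3 := cocycle_triangle hω F (0, 0) (0, 0) (0, 0)
  have e1 : F.comp (affineSimplex ![(0, 1), (1, 1)]) = τ := by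
    ext t
    rw [← extendPath_apply τ t]
    simp [F, affineSimplex_pair_apply, stdSimplex.add_eq_one]
  have v0 := extendPath_apply τ (stdSimplex.vertex 0)
  have v1 := extendPath_apply τ (stdSimplex.vertex 1)
  simp only [stdSimplex.vertex_coe, Pi.single_eq_same] at v0 v1
  rw [Pi.single_eq_of_ne (by decide)] at v0
  have e2 : F.comp (affineSimplex ![(0, 0), (0, 1)]) =
      affineSimplex ![0, τ (stdSimplex.vertex 0)] := by
    ext t
    simp [F, affineSimplex_pair_apply, ← v0]
  have e3 : F.comp (affineSimplex ![(1, 0), (1, 1)]) =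
      affineSimplex ![0, τ (stdSimplex.vertex 1)] := by
    ext t
    simp [F, affineSimplex_pair_apply, stdSimplex.add_eq_one, ← v1]
  have e4 : F.comp (affineSimplex ![(0, 0), (1, 0)]) =
      F.comp (affineSimplex ![(0, 0), (0, 0)]) := by
    ext t
    simp [F, affineSimplex_pair_apply]
  rw [coboundary_pointCochain]
  rw [e1, e2] at key1
  rw [e3, e4] at key2
  linarith

end Cone

/-! ### A generator of the compactly supported cohomology of the line -/

section EuclideanLine

/-- The `0`-cochain on the real line that is the characteristic function of `[0, ∞)`. -/
noncomputable def stepFunction (x : EuclideanSpace ℝ (Fin 1)) : ℤ := if 0 ≤ x 0 then 1 else 0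

/-- The standard generator of `H^1_c(ℝ; ℤ)`, the coboundary of the characteristic function of
`[0, ∞)`. -/
noncomputable def stepCocycle : SingularCochain 1 (EuclideanSpace ℝ (Fin 1)) :=
  coboundary (pointCochain stepFunction)

lemma stepCocycle_apply (τ : SingularSimplex 1 (EuclideanSpace ℝ (Fin 1))) :
    stepCocycle τ = stepFunction (τ (stdSimplex.vertex 1)) -
      stepFunction (τ (stdSimplex.vertex 0)) :=
  coboundary_pointCochain _ _

/-- By the intermediate value theorem a path that misses the origin stays on one side of it, where
the step function is constant. -/
lemma hasCompactSupp_stepCocycle : HasCompactSupp stepCocycle := by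
  refine ⟨{0}, isCompact_singleton, fun τ hτ => ?_⟩
  rw [Set.disjoint_singleton_right] at hτ
  have hc : Continuous fun t => τ t 0 := by fun_prop
  have h0 : ∀ t, τ t 0 ≠ 0 := fun t ht => hτ ⟨t, by
    ext i
    rw [Subsingleton.elim i 0, ht]
    rfl⟩
  have hconn := isPreconnected_range hc
  have key : ∀ s t, ¬ (τ s 0 < 0 ∧ 0 ≤ τ t 0) := by
    rintro s t ⟨hs, ht⟩
    obtain ⟨r, hr⟩ := hconn.ordConnected.out ⟨s, rfl⟩ ⟨t, rfl⟩ ⟨hs.le, ht⟩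
    exact h0 r hr
  rw [stepCocycle_apply, stepFunction, stepFunction]
  have h1 := key (stdSimplex.vertex 0) (stdSimplex.vertex 1)
  have h2 := key (stdSimplex.vertex 1) (stdSimplex.vertex 0)
  split_ifs <;> simp_all

/-- A function whose differences are given by a compactly supported cochain is constant near
either end of the line. -/
lemma eq_of_coboundary_hasCompactSupp {g : EuclideanSpace ℝ (Fin 1) → ℤ}
    (hg : HasCompactSupp (coboundary (pointCochain g))) :
    ∃ R : ℝ, 0 ≤ R ∧ ∀ x y : EuclideanSpace ℝ (Fin 1),
      (R < x 0 ∧ R < y 0 ∨ x 0 < -R ∧ y 0 < -R) → g x = g y := by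
  obtain ⟨K, hK, hω⟩ := hg
  obtain ⟨R, hR⟩ := hK.isBounded.exists_norm_le
  refine ⟨max R 0, le_max_right _ _, fun x y hxy => ?_⟩
  -- The segment joining two points beyond the bound on the same side stays beyond it, so it misses
  -- `K`.
  have h := hω (affineSimplex ![x, y]) (by
    rw [Set.disjoint_left]
    rintro _ ⟨t, rfl⟩ ht
    have h1 := (PiLp.norm_apply_le _ 0).trans (hR _ ht)
    rw [affineSimplex_pair_apply] at h1
    simp only [PiLp.add_apply, PiLp.smul_apply, smul_eq_mul, Real.norm_eq_abs] at h1
    have ha := stdSimplex.add_eq_one t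
    have hz := stdSimplex.zero_le t 0
    have hz' := stdSimplex.zero_le t 1
    rw [abs_le] at h1
    have hm := le_max_left R 0
    rcases hxy with ⟨hx, hy⟩ | ⟨hx, hy⟩
    · rcases hz.eq_or_lt with h0 | h0 <;> nlinarith
    · rcases hz.eq_or_lt with h0 | h0 <;> nlinarith)
  rw [coboundary_pointCochain, affineSimplex_pair_vertex_zero, affineSimplex_pair_vertex_one] at h
  linarith

theorem isCompactGenerator_stepCocycle : IsCompactGenerator stepCocycle := by
  refine ⟨⟨hasCompactSupp_stepCocycle, coboundary_coboundary_pointCochain _⟩, ?_⟩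
  rintro ω ⟨hsupp, hω⟩
  have hg := cocycle_eq_coboundary hω
  set g : EuclideanSpace ℝ (Fin 1) → ℤ := fun x => ω (affineSimplex ![0, x])
  rw [hg] at hsupp
  obtain ⟨R, hR0, hR⟩ := eq_of_coboundary_hasCompactSupp hsupp
  let pos : EuclideanSpace ℝ (Fin 1) := WithLp.toLp 2 fun _ => R + 1
  let neg : EuclideanSpace ℝ (Fin 1) := WithLp.toLp 2 fun _ => -(R + 1)
  have hpos : R < pos 0 := lt_add_one R
  have hneg : neg 0 < -R := neg_lt_neg (lt_add_one R)
  -- The multiple is the total jump of `g` from one end to the other. With this choice the corrected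
  -- function vanishes at both ends; `0 ≤ R` ensures that the step function is already 1 or 0 there.
  refine ⟨g pos - g neg,
    pointCochain fun x => g x - g neg - (g pos - g neg) * stepFunction x, ?_, ?_⟩
  · refine ⟨Metric.closedBall 0 R, isCompact_closedBall 0 R, fun τ hτ => ?_⟩
    have hx := Set.disjoint_left.1 hτ ⟨stdSimplex.vertex 0, rfl⟩
    rw [pointCochain]
    set x := τ (stdSimplex.vertex 0)
    rw [mem_closedBall_zero_iff, EuclideanSpace.norm_eq, Fin.sum_univ_one,
      Real.sqrt_sq (norm_nonneg _), Real.norm_eq_abs, not_le, lt_abs] at hx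
    rcases hx with hx | hx
    · rw [hR x pos (Or.inl ⟨hx, hpos⟩), stepFunction, if_pos (by linarith)]
      ring
    · rw [hR x neg (Or.inr ⟨by linarith, hneg⟩), stepFunction, if_neg (by linarith)]
      ring
  · funext τ
    rw [coboundary_pointCochain, Pi.sub_apply, Pi.smul_apply, stepCocycle_apply, smul_eq_mul, hg,
      coboundary_pointCochain]
    ring

end EuclideanLine

/-! ### The realization of the triangulated line as `ℝ` -/

section Line

variable {Γ : Type} [Group Γ] (f : Γ → ℤ) (hf : ∀ γ δ, f (γ * δ) = f γ + f δ)

lemma map_inv_of_map_mul {Γ : Type} [Group Γ] (f : Γ → ℤ)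
    (hf : ∀ γ δ, f (γ * δ) = f γ + f δ) (γ : Γ) : f γ⁻¹ = -f γ := by
  have h1 := hf 1 1
  have h2 := hf γ⁻¹ γ
  rw [mul_one] at h1
  rw [inv_mul_cancel] at h2
  omega

lemma line_translate_apply (γ : Γ) (x : (line f hf).Realization) (m : ℤ) :
    ((line f hf).translate γ x).1 m = x.1 (m - f γ) := by
  change x.1 (m + f γ⁻¹) = _
  rw [map_inv_of_map_mul f hf, sub_eq_add_neg]

variable {f hf}

/-- Every point of the realization of the line lies on an edge. -/
lemma exists_edge (x : (line f hf).Realization) :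
    ∃ m : ℤ, (∀ v, v ≠ m → v ≠ m + 1 → x.1 v = 0) ∧ x.1 m + x.1 (m + 1) = 1 := by
  obtain ⟨x, s, ⟨-, m, hm⟩, h0, -, hsum⟩ := x
  refine ⟨m, fun v h1 h2 => h0 v fun hv => ?_, ?_⟩
  · have := hm hv
    simp only [Finset.mem_insert, Finset.mem_singleton] at this
    tauto
  · change x m + x (m + 1) = 1
    rw [← hsum, Finset.sum_subset hm fun v _ hv => h0 v hv]
    exact (Finset.sum_pair (by omega)).symm

lemma coord_nonneg (x : (line f hf).Realization) (m : ℤ) : 0 ≤ x.1 m := by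
  obtain ⟨x, s, -, -, h, -⟩ := x
  exact h m

variable (f hf) in
/-- The coordinate on the realization of the line that is linear on edges and equal to `m` at the
vertex `m`. -/
noncomputable def lineCoord (x : (line f hf).Realization) : ℝ := ∑ᶠ m : ℤ, x.1 m * (m : ℝ)

lemma lineCoord_eq_of_edge {x : (line f hf).Realization} {m : ℤ}
    (h : ∀ v, v ≠ m → v ≠ m + 1 → x.1 v = 0) (h1 : x.1 m + x.1 (m + 1) = 1) :
    lineCoord f hf x = m + x.1 (m + 1) := by
  rw [lineCoord, finsum_eq_sum_of_support_subset (s := {m, m + 1}), Finset.sum_pair (by omega)]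
  · push_cast
    linear_combination (m : ℝ) * h1
  · intro v hv
    by_contra hne
    simp only [Finset.coe_insert, Finset.coe_singleton, Set.mem_insert_iff,
      Set.mem_singleton_iff, not_or] at hne
    exact hv (by simp [h v hne.1 hne.2])

/-- The sum is locally finite: on the open star of a vertex `v` only the coordinates at `v - 1`,
`v`, `v + 1` can be nonzero. -/
lemma continuous_lineCoord : Continuous (lineCoord f hf) := by
  refine continuous_finsum (fun m => ?_) fun x => ?_
  · exact ((continuous_apply m).comp continuous_subtype_val).mul continuous_const
  obtain ⟨m, -, h1⟩ := exists_edge x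
  obtain ⟨v, hv⟩ : ∃ v, x.1 v ≠ 0 := by
    by_contra! h
    simp [h] at h1
  refine ⟨{y | y.1 v ≠ 0}, IsOpen.mem_nhds ?_ hv, ?_⟩
  · exact isOpen_ne.preimage ((continuous_apply v).comp continuous_subtype_val)
  · refine (Set.finite_Icc (v - 1) (v + 1)).subset ?_
    rintro w ⟨y, hyw, hyv⟩
    obtain ⟨n, hn, -⟩ := exists_edge y
    have hv' : v = n ∨ v = n + 1 := by
      by_contra! h
      exact hyv (hn v h.1 h.2)
    have hw' : w = n ∨ w = n + 1 := by
      by_contra! h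
      exact hyw (by simp [hn w h.1 h.2])
    rw [Set.mem_Icc]
    omega

/-- The barycentric coordinate at the vertex `m` of the point `y` of the line. -/
noncomputable def hat (y : ℝ) (m : ℤ) : ℝ := max 0 (1 - |y - m|)

lemma hat_floor (y : ℝ) : hat y ⌊y⌋ = 1 - Int.fract y := by
  rw [hat, Int.self_sub_floor, abs_of_nonneg (Int.fract_nonneg y),
    max_eq_right (by linarith [Int.fract_lt_one y])]

lemma hat_floor_add_one (y : ℝ) : hat y (⌊y⌋ + 1) = Int.fract y := by
  have h : y - ((⌊y⌋ + 1 : ℤ) : ℝ) = -(1 - Int.fract y) := by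
    push_cast
    linarith [Int.floor_add_fract y]
  rw [hat, h, abs_neg, abs_of_nonneg (by linarith [Int.fract_lt_one y]), sub_sub_cancel,
    max_eq_right (Int.fract_nonneg y)]

lemma hat_eq_zero {y : ℝ} {m : ℤ} (h : 1 ≤ |y - m|) : hat y m = 0 :=
  max_eq_left (by linarith)

lemma hat_eq_zero_of_ne_floor {y : ℝ} {m : ℤ} (h : m ≠ ⌊y⌋) (h1 : m ≠ ⌊y⌋ + 1) : hat y m = 0 := by
  apply hat_eq_zero
  have hl := Int.floor_le y
  have hu := Int.lt_floor_add_one y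
  rcases lt_or_gt_of_ne h with h2 | h2
  · have : (m : ℝ) + 1 ≤ ⌊y⌋ := by exact_mod_cast h2
    exact le_abs.2 (Or.inl (by linarith))
  · have : (⌊y⌋ : ℝ) + 1 + 1 ≤ m := by
      have : ⌊y⌋ + 1 + 1 ≤ m := by omega
      exact_mod_cast this
    exact le_abs.2 (Or.inr (by linarith))

variable (f hf) in
/-- The point of the realization of the line with a given coordinate. -/
noncomputable def linePoint (y : ℝ) : (line f hf).Realization :=
  ⟨hat y, {⌊y⌋, ⌊y⌋ + 1}, ⟨Finset.insert_nonempty _ _, ⌊y⌋, subset_rfl⟩,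
    fun v hv => by
      simp only [Finset.mem_insert, Finset.mem_singleton, not_or] at hv
      exact hat_eq_zero_of_ne_floor hv.1 hv.2,
    fun v => le_max_left _ _, by
      rw [Finset.sum_pair (by omega), hat_floor, hat_floor_add_one]
      ring⟩

lemma continuous_linePoint : Continuous (linePoint f hf) := by
  refine Continuous.subtype_mk (continuous_pi fun m => ?_) _
  unfold hat
  fun_prop

lemma lineCoord_linePoint (y : ℝ) : lineCoord f hf (linePoint f hf y) = y := by
  rw [lineCoord_eq_of_edge (m := ⌊y⌋) (fun v h h1 => hat_eq_zero_of_ne_floor h h1)]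
  · exact (congrArg _ (hat_floor_add_one y)).trans (Int.floor_add_fract y)
  · exact (congrArg₂ _ (hat_floor y) (hat_floor_add_one y)).trans (by ring)

lemma linePoint_lineCoord (x : (line f hf).Realization) :
    linePoint f hf (lineCoord f hf x) = x := by
  obtain ⟨m, h, h1⟩ := exists_edge x
  have hm := coord_nonneg x m
  have hm1 := coord_nonneg x (m + 1)
  -- On the edge from `m` to `m + 1`, the distances to its two ends are the opposite barycentric
  -- coordinates, so `hat` recovers both.
  rw [lineCoord_eq_of_edge h h1]
  refine Subtype.ext (funext fun v => ?_)
  change hat _ v = x.1 v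
  by_cases hv : v = m
  · subst hv
    rw [hat, add_sub_cancel_left, abs_of_nonneg hm1, max_eq_right (by linarith)]
    linarith
  by_cases hv1 : v = m + 1
  · subst hv1
    have : (m : ℝ) + x.1 (m + 1) - ((m + 1 : ℤ) : ℝ) = -(x.1 m) := by
      push_cast
      linarith
    rw [hat, this, abs_neg, abs_of_nonneg hm, max_eq_right (by linarith)]
    linarith
  rw [h v hv hv1]
  apply hat_eq_zero
  rcases lt_or_gt_of_ne hv with h2 | h2
  · have : (v : ℝ) + 1 ≤ m := by exact_mod_cast h2
    exact le_abs.2 (Or.inl (by linarith))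
  · have : (m : ℝ) + 1 + 1 ≤ v := by
      have : m + 1 + 1 ≤ v := by omega
      exact_mod_cast this
    exact le_abs.2 (Or.inr (by linarith))

variable (f hf) in
/-- The realization of the line is the real line. -/
noncomputable def lineHomeomorph : (line f hf).Realization ≃ₜ ℝ where
  toFun := lineCoord f hf
  invFun := linePoint f hf
  left_inv := linePoint_lineCoord
  right_inv := lineCoord_linePoint
  continuous_toFun := continuous_lineCoord
  continuous_invFun := continuous_linePoint

lemma lineHomeomorph_translate (γ : Γ) (x : (line f hf).Realization) :
    lineHomeomorph f hf ((line f hf).translate γ x) = lineHomeomorph f hf x + f γ := by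
  change lineCoord f hf _ = lineCoord f hf x + f γ
  obtain ⟨m, h, h1⟩ := exists_edge x
  rw [lineCoord_eq_of_edge h h1, lineCoord_eq_of_edge (m := m + f γ), line_translate_apply,
    show m + f γ + 1 - f γ = m + 1 by ring]
  · push_cast
    ring
  · intro v h2 h3
    rw [line_translate_apply]
    exact h _ (by omega) (by omega)
  · rw [line_translate_apply, line_translate_apply, add_sub_cancel_right,
      show m + f γ + 1 - f γ = m + 1 by ring, h1]

/-! ### The Lipschitz map on the line -/

variable (f hf) in
/-- The Lipschitz map `α(γ, x) = -c γ⁻¹(x)`, as a family of homeomorphisms. -/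
noncomputable def lineMapHomeomorph {c : ℝ} (hc : c ≠ 0) (γ : Γ) :
    (line f hf).Realization ≃ₜ EuclideanSpace ℝ (Fin 1) :=
  (lineHomeomorph f hf).trans <| (Homeomorph.addRight (-(f γ : ℝ))).trans <|
    (Homeomorph.mulLeft₀ (-c) (neg_ne_zero.2 hc)).trans <|
      (Homeomorph.funUnique (Fin 1) ℝ).symm.trans (PiLp.homeomorph 2 fun _ : Fin 1 => ℝ).symm

lemma lineMapHomeomorph_apply {c : ℝ} (hc : c ≠ 0) (γ : Γ) (x : (line f hf).Realization)
    (i : Fin 1) :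
    lineMapHomeomorph f hf hc γ x i = -c * (lineHomeomorph f hf x - f γ) := by
  rw [sub_eq_add_neg]
  rfl

variable (f hf) in
/-- The map `α(γ, x) = -c γ⁻¹(x)`. -/
noncomputable def lineMap {c : ℝ} (hc : c ≠ 0) (γ : Γ) :
    C((line f hf).Realization, EuclideanSpace ℝ (Fin 1)) :=
  ⟨lineMapHomeomorph f hf hc γ, (lineMapHomeomorph f hf hc γ).continuous⟩

lemma lineMap_apply {c : ℝ} (hc : c ≠ 0) (γ : Γ) (x : (line f hf).Realization) (i : Fin 1) :
    lineMap f hf hc γ x i = -c * (lineHomeomorph f hf x - f γ) :=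
  lineMapHomeomorph_apply hc γ x i

/-- Since `f` is additive and `f x⁻¹ = -f x`, each letter of the word adds at most 1. -/
lemma mul_abs_le_length {Γ : Type} [Group Γ] {f : Γ → ℤ}
    (hf : ∀ γ δ, f (γ * δ) = f γ + f δ) {S : Finset Γ} {c : ℝ} (hc : ∀ s ∈ S, c * |(f s : ℝ)| ≤ 1)
    (hc0 : 0 ≤ c) (l : List Γ) (hl : ∀ x ∈ l, x ∈ S ∨ x⁻¹ ∈ S) : c * |(f l.prod : ℝ)| ≤ l.length := by
  induction l with
  | nil =>
    have h1 : f 1 = 0 := by simpa using hf 1 1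
    simp [h1]
  | cons g l ih =>
    have hg : c * |(f g : ℝ)| ≤ 1 := by
      rcases hl g (by simp) with h | h
      · exact hc g h
      · have := hc _ h
        rwa [map_inv_of_map_mul f hf, Int.cast_neg, abs_neg] at this
    have hl' := ih fun x hx => hl x (by simp [hx])
    rw [List.prod_cons, hf, List.length_cons]
    push_cast
    have := mul_le_mul_of_nonneg_left (abs_add_le (f g : ℝ) (f l.prod)) hc0
    linarith

/-- Because `S` generates, the infimum defining the word length is over a nonempty set and is
attained, rather than being the default 0. -/
lemma exists_word {S : Finset Γ} (hS : Subgroup.closure (S : Set Γ) = ⊤) (g : Γ) :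
    ∃ l : List Γ, l.length = wordLength S g ∧ (∀ x ∈ l, x ∈ S ∨ x⁻¹ ∈ S) ∧ l.prod = g := by
  have hg : g ∈ (Subgroup.closure (S : Set Γ)).toSubmonoid := hS.symm ▸ Subgroup.mem_top g
  rw [Subgroup.closure_toSubmonoid] at hg
  obtain ⟨l, hl, hprod⟩ := Submonoid.exists_list_of_mem_closure hg
  have hmem : l.length ∈
      {n | ∃ l : List Γ, l.length = n ∧ (∀ x ∈ l, x ∈ S ∨ x⁻¹ ∈ S) ∧ l.prod = g} :=
    ⟨l, rfl, fun x hx => by simpa using hl x hx, hprod⟩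
  exact Nat.sInf_mem ⟨_, hmem⟩

lemma isLipschitzMap_lineMap {S : Finset Γ} (hS : Subgroup.closure (S : Set Γ) = ⊤) {c : ℝ}
    (hc0 : 0 < c) (hc : ∀ s ∈ S, c * |(f s : ℝ)| ≤ 1) :
    IsLipschitzMap (line f hf) S (lineMap f hf hc0.ne') where
  invariant g γ x := by
    ext i
    rw [lineMap_apply, lineMap_apply, lineHomeomorph_translate, hf]
    push_cast
    ring
  proper γ := (lineMapHomeomorph f hf hc0.ne' γ).isProperMap
  lipschitz x γ δ := by
    rw [EuclideanSpace.dist_eq, Fin.sum_univ_one, lineMap_apply, lineMap_apply,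
      Real.sqrt_sq dist_nonneg, Real.dist_eq]
    obtain ⟨l, hl, hlS, hprod⟩ := exists_word hS (γ⁻¹ * δ)
    have h := mul_abs_le_length hf hc hc0.le l hlS
    rw [hprod, hf, map_inv_of_map_mul f hf, hl] at h
    -- The point `x` cancels in the difference, leaving exactly `c |f(γ⁻¹δ)|`.
    refine le_of_eq_of_le ?_ h
    rw [← abs_of_pos hc0, ← abs_mul, ← abs_neg, abs_of_pos hc0]
    congr 1
    push_cast
    ring

end Line

/-! ### Evaluation of the slant product on vertices -/

section Slant

variable {Γ : Type} [Group Γ]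

open Classical in
lemma charMap_apply {V : Type} (P : GComplex Γ V) {m : ℕ} (σ : P.Simplex m)
    (t : stdSimplex ℝ (Fin (m + 1))) (v : V) :
    (P.charMap σ t).1 v = ∑ j, if σ.1 j = v then t j else 0 := rfl

lemma stairSimplex_vertex {V : Type} (P : GComplex Γ V) {n k m : ℕ}
    (α : Γ → C(P.Realization, EuclideanSpace ℝ (Fin n))) (γ : Fin (k + 1) → Γ)
    (σ : P.Simplex m) (p : Fin (k + m + 1) → Fin (k + 1) × Fin (m + 1)) (j : Fin (k + m + 1)) :
    stairSimplex P α γ σ p (stdSimplex.vertex j) =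
      α (γ (p j).1) (P.charMap σ (stdSimplex.vertex (p j).2)) := by
  simp only [stairSimplex, alphaBar, ContinuousMap.comp_apply, ContinuousMap.prod_eval,
    ContinuousMap.coe_mk, stdSimplex.map_vertex, stdSimplex.vertex_coe]
  rw [Finset.sum_eq_single (p j).1]
  · simp
  · intro i _ hi
    simp [hi]
  · simp

/-- An edge times a vertex is not subdivided: the second coordinate cannot move, so the first must
increase at the only step. -/
lemma strictMono_stair_iff (p : Fin 2 → Fin 2 × Fin 1) :
    StrictMono p ↔ p = fun j => (j, 0) := by
  constructor
  · intro hp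
    have h : p 0 < p 1 := hp Fin.zero_lt_one
    rw [Prod.lt_iff] at h
    have h0 : (p 0).1 = 0 := by omega
    have h1 : (p 1).1 = 1 := by omega
    funext j
    refine Prod.ext ?_ (Subsingleton.elim _ _)
    fin_cases j
    exacts [h0, h1]
  · rintro rfl i j hij
    exact Prod.lt_iff.2 (Or.inl ⟨hij, le_rfl⟩)

lemma phi_one_zero {V : Type} (P : GComplex Γ V)
    (α : Γ → C(P.Realization, EuclideanSpace ℝ (Fin 1)))
    (ω : SingularCochain 1 (EuclideanSpace ℝ (Fin 1))) (γ : Fin 2 → Γ) (σ : P.Simplex 0) :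
    phi (k := 1) (m := 0) P α ω γ σ =
      ω (stairSimplex (k := 1) (m := 0) P α γ σ fun j => (j, 0)) := by
  classical
  rw [phi, Finset.sum_filter, Finset.sum_eq_single (fun j => (j, 0))]
  · rw [if_pos ((strictMono_stair_iff _).2 rfl)]
    simp [stairArea]
  · exact fun p _ hp => if_neg fun h => hp ((strictMono_stair_iff p).1 h)
  · simp

/-- The summand is the indicator of `(b, a]` if `b ≤ a`, and minus that of `(a, b]` otherwise. -/
lemma finsum_indicator_sub (a b : ℤ) :
    ∑ᶠ v : ℤ, ((if v ≤ a then 1 else 0) - (if v ≤ b then 1 else 0) : ℤ) = a - b := by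
  rcases le_total b a with h | h
  · rw [finsum_eq_sum_of_support_subset (s := Finset.Ioc b a),
      Finset.sum_congr rfl (g := fun _ => 1)]
    · simp [h]
    · intro v hv
      rw [Finset.mem_Ioc] at hv
      rw [if_pos hv.2, if_neg (by omega), sub_zero]
    · intro v hv
      rw [Finset.coe_Ioc, Set.mem_Ioc]
      rw [Function.mem_support] at hv
      split_ifs at hv <;> omega
  · rw [finsum_eq_sum_of_support_subset (s := Finset.Ioc a b),
      Finset.sum_congr rfl (g := fun _ => -1)]
    · simp [h]
    · intro v hv
      rw [Finset.mem_Ioc] at hv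
      rw [if_neg (by omega), if_pos hv.2, zero_sub]
    · intro v hv
      rw [Finset.coe_Ioc, Set.mem_Ioc]
      rw [Function.mem_support] at hv
      split_ifs at hv <;> omega

variable {f : Γ → ℤ} {hf : ∀ γ δ, f (γ * δ) = f γ + f δ}

lemma lineHomeomorph_charMap (σ : (line f hf).Simplex 0) (t : stdSimplex ℝ (Fin 1)) :
    lineHomeomorph f hf ((line f hf).charMap σ t) = σ.1 0 := by
  have hval : ∀ v, ((line f hf).charMap σ t).1 v = if σ.1 0 = v then 1 else 0 := by
    intro v
    rw [charMap_apply]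
    refine (Fin.sum_univ_one _).trans ?_
    split_ifs
    · exact stdSimplex.eq_one_of_unique t 0
    · rfl
  refine (lineCoord_eq_of_edge (m := σ.1 0) (fun v h _ => ?_) ?_).trans ?_
  · rw [hval, if_neg (Ne.symm h)]
  · rw [hval, hval, if_pos rfl, if_neg (by omega), add_zero]
  · rw [hval, if_neg (by omega), add_zero]

/-- The minus sign in `α` turns `[0, ∞)` into the condition `v ≤ f γ`, so that the final count is
`f` and not `-f`. -/
lemma stepFunction_lineMap {c : ℝ} (hc : 0 < c) (γ : Γ) (σ : (line f hf).Simplex 0)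
    (t : stdSimplex ℝ (Fin 1)) :
    stepFunction (lineMap f hf hc.ne' γ ((line f hf).charMap σ t)) =
      if σ.1 0 ≤ f γ then 1 else 0 := by
  rw [stepFunction, lineMap_apply, lineHomeomorph_charMap]
  refine if_congr ?_ rfl rfl
  rw [neg_mul, neg_nonneg, mul_nonpos_iff_pos_imp_nonpos]
  simp [hc, hc.le]

variable (f hf) in
/-- The vertices of the line are the integers. -/
lemma bijective_line_vertex : Function.Bijective fun σ : (line f hf).Simplex 0 => σ.1 0 := by
  constructor
  · intro σ τ h
    refine Subtype.ext (funext fun i => ?_)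
    rw [Fin.fin_one_eq_zero i]
    exact h
  · intro v
    refine ⟨⟨fun _ => v, ⟨{v}, (line f hf).complex.singleton_mem v, ?_⟩, fun i j hij => ?_⟩, rfl⟩
    · simp
    · exact absurd (Subsingleton.elim (α := Fin 1) i j) hij.ne

/-- Only the endpoint values of each staircase path matter, so the sum over vertices becomes the
signed count of integers in `finsum_indicator_sub`. -/
lemma slant_lineMap {c : ℝ} (hc : 0 < c) (γ : Fin 2 → Γ) :
    slant (k := 1) (m := 0) (line f hf) (lineMap f hf hc.ne') stepCocycle (fun _ => (1 : ℤ)) γ =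
      f (γ 1) - f (γ 0) := by
  rw [slant, ← finsum_indicator_sub]
  refine finsum_eq_of_bijective _ (bijective_line_vertex f hf) fun σ => ?_
  rw [phi_one_zero, stepCocycle_apply]
  refine (mul_one _).trans ?_
  have h (j : Fin 2) := stairSimplex_vertex (k := 1) (m := 0) (line f hf) (lineMap f hf hc.ne') γ σ
    (fun j => (j, 0)) j
  refine (congrArg₂ _ (congrArg _ (h 1)) (congrArg _ (h 0))).trans ?_
  rw [stepFunction_lineMap hc, stepFunction_lineMap hc]

end Slant

/-! ### Degree-one classes as homomorphisms -/

section GroupCohomology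

variable {Γ : Type} [Group Γ]

/-- Every class in `H^1(Γ; ℤ)` is represented by a homomorphism `Γ → ℤ`. -/
lemma exists_hom_isClassOf (a : groupCohomology (Rep.trivial ℤ Γ ℤ) 1) :
    ∃ f : Γ → ℤ, (∀ γ δ, f (γ * δ) = f γ + f δ) ∧
      IsClassOf (L := Rep.trivial ℤ Γ ℤ) (fun g : Fin 1 → Γ => f (g 0)) a := by
  induction a using groupCohomology_induction_on with
  | h y =>
    let φ : (Fin 1 → Γ) → ℤ := groupCohomology.iCocycles (Rep.trivial ℤ Γ ℤ) 1 y
    have hφ : inhomogeneousCochains.d (Rep.trivial ℤ Γ ℤ) 1 φ = 0 := by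
      rw [← groupCohomology.inhomogeneousCochains.d_def]
      exact CategoryTheory.ConcreteCategory.congr_hom
        ((groupCohomology.inhomogeneousCochains (Rep.trivial ℤ Γ ℤ)).iCycles_d 1 2) y
    have hconst : (fun g : Fin 1 → Γ => φ fun _ => g 0) = φ := by
      funext g
      congr 1
      funext i
      rw [Subsingleton.elim i 0]
    refine ⟨fun γ => φ fun _ => γ, fun γ δ => ?_, ?_⟩
    · have h := congrFun hφ ![γ, δ]
      have h0 : (Fin.contractNth (0 : Fin 2) (· * ·) ![γ, δ] : Fin 1 → Γ) = fun _ => γ * δ := by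
        funext i
        fin_cases i
        rfl
      have h1 : (Fin.contractNth (1 : Fin 2) (· * ·) ![γ, δ] : Fin 1 → Γ) = fun _ => γ := by
        funext i
        fin_cases i
        rfl
      have h2 : (fun i : Fin 1 => ![γ, δ] i.succ) = fun _ => δ := by
        funext i
        fin_cases i
        rfl
      rw [inhomogeneousCochains.d_hom_apply, Fin.sum_univ_two, h0, h1, h2] at h
      simp at h
      replace h : (φ fun _ => δ) + (-(φ fun _ => γ * δ) + φ fun _ => γ) = 0 := h
      change (φ fun _ => γ * δ) = (φ fun _ => γ) + φ fun _ => δ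
      linarith
    · rw [IsClassOf, hconst]
      refine ⟨hφ, congrArg _ ?_⟩
      -- Cocycles embed in cochains, so the rebuilt cocycle can be compared with `y` there.
      apply (ModuleCat.mono_iff_injective
        (groupCohomology.iCocycles (Rep.trivial ℤ Γ ℤ) 1)).1 inferInstance
      exact groupCohomology.iCocycles_mk (A := Rep.trivial ℤ Γ ℤ) φ hφ

end GroupCohomology

lemma exists_scale {Γ : Type} (S : Finset Γ) (f : Γ → ℤ) :
    ∃ c : ℝ, 0 < c ∧ ∀ s ∈ S, c * |(f s : ℝ)| ≤ 1 := by
  have hpos : 0 < 1 + ∑ s ∈ S, |(f s : ℝ)| := by positivity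
  -- The sum dominates every `|f s|`; the added 1 keeps it positive even if `f` vanishes on `S`.
  refine ⟨(1 + ∑ s ∈ S, |(f s : ℝ)|)⁻¹, inv_pos.2 hpos, fun s hs => ?_⟩
  rw [inv_mul_le_one₀ hpos]
  have := Finset.single_le_sum (f := fun s => |(f s : ℝ)|) (fun _ _ => abs_nonneg _) hs
  linarith

/-! ### The line realizes the given class -/

section Realizes

variable {Γ : Type} [Group Γ] {f : Γ → ℤ} {hf : ∀ γ δ, f (γ * δ) = f γ + f δ}

lemma realizes_lineMap {S : Finset Γ} (hS : Subgroup.closure (S : Set Γ) = ⊤)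
    {a : groupCohomology (Rep.trivial ℤ Γ ℤ) 1}
    (ha : IsClassOf (L := Rep.trivial ℤ Γ ℤ) (fun g : Fin 1 → Γ => f (g 0)) a)
    {c : ℝ} (hc0 : 0 < c) (hc : ∀ s ∈ S, c * |(f s : ℝ)| ≤ 1) :
    Realizes (k := 1) (m := 0) S (L := Rep.trivial ℤ Γ ℤ) (line f hf) (lineMap f hf hc0.ne')
      (fun _ => (1 : ℤ)) a := by
  refine ⟨isLipschitzMap_lineMap hS hc0 hc, fun _ _ => rfl, trivial, stepCocycle,
    isCompactGenerator_stepCocycle, ?_⟩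
  convert ha using 1
  funext g
  refine (slant_lineMap hc0 _).trans ?_
  have h1 : f 1 = 0 := by simpa using hf 1 1
  -- The inhomogeneous cocycle is the homogeneous one on `[1, g]`, with value `f g - f 1 = f g`.
  have hp : Fin.partialProd g 1 = g 0 := by
    simpa using Fin.partialProd_succ g 0
  rw [hp, Fin.partialProd_zero, h1, sub_zero]

end Realizes

end LipschitzCohomology

theorem mainTheorem11 {Γ : Type} [Group Γ] (S : Finset Γ)
    (hS : Subgroup.closure (S : Set Γ) = ⊤)
    (a : groupCohomology (Rep.trivial ℤ Γ ℤ) 1) :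
    IsLipschitzClass S a ∧
    ∃ (f : Γ → ℤ) (hf : ∀ γ δ, f (γ * δ) = f γ + f δ),
      IsClassOf (L := Rep.trivial ℤ Γ ℤ) (fun g : Fin 1 → Γ => f (g 0)) a ∧
      ∃ e : (line f hf).Realization ≃ₜ ℝ,
        (∀ x, e x = ∑ᶠ m : ℤ, x.1 m * (m : ℝ)) ∧
        (∀ γ x, e ((line f hf).translate γ x) = e x + (f γ : ℝ)) ∧
        ∀ c : ℝ, 0 < c → (∀ s ∈ S, c * |(f s : ℝ)| ≤ 1) →
          ∃ α : Γ → C((line f hf).Realization, EuclideanSpace ℝ (Fin (1 + 0))),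
            (∀ γ x i, α γ x i = c * -(e ((line f hf).translate γ⁻¹ x))) ∧
            Realizes S (L := Rep.trivial ℤ Γ ℤ) (line f hf) α (fun _ => (1 : ℤ)) a := by
  obtain ⟨f, hf, ha⟩ := exists_hom_isClassOf a
  refine ⟨?_, f, hf, ha, lineHomeomorph f hf, fun _ => rfl, lineHomeomorph_translate, ?_⟩
  · obtain ⟨c, hc0, hc⟩ := exists_scale S f
    exact ⟨ℤ, line f hf, (lineHomeomorph f hf).symm.surjective.connectedSpace
      (lineHomeomorph f hf).symm.continuous, 0, lineMap f hf hc0.ne', fun _ => (1 : ℤ),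
      realizes_lineMap hS ha hc0 hc⟩
  · intro c hc0 hc
    refine ⟨lineMap f hf hc0.ne', fun γ x i => ?_, realizes_lineMap hS ha hc0 hc⟩
    refine (lineMap_apply hc0.ne' γ x i).trans ?_
    rw [lineHomeomorph_translate, map_inv_of_map_mul f hf]
    push_cast
    ring
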